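/- Let $N\ge 1$ be an integer, let $\theta\in\mathbb{C}$ be a primitive $N$-th root of unity, and let $f:\mathbb{C}\to\mathbb{R}$ be continuous. Then $f$ satisfies the Kakutani–Nagumo–Walsh equation $$\frac1N\sum_{k=0}^{N-1} f(x+\theta^k y)=f(x)\qquad\text{for all } x,y\in\mathbb{C}$$ if and only if there is a harmonic polynomial $p\in\mathbb{R}[x,y]$ (that is, $\partial_x^2p+\partial_y^2p=0$) of total degree at most $N-1$ such that $f(x+iy)=p(x,y)$ for all $x,y\in\mathbb{R}$. -/

import Mathlib

/-- The Kakutani–Nagumo–Walsh equation for a function `f` on `ℂ`: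
`(1 / N) ∑_{k=0}^{N-1} f (x + θ ^ k * y) = f x` for all `x, y ∈ ℂ`. -/
def SolvesKNW (N : ℕ) (θ : ℂ) (f : ℂ → ℝ) : Prop :=
  ∀ x y : ℂ, (1 / (N : ℝ)) * ∑ k ∈ Finset.range N, f (x + θ ^ k * y) = f x

/-- A real polynomial `p(x, y)` in two real variables is harmonic if the function
`x + iy ↦ p(x, y)` is harmonic on the whole plane. -/
def IsHarmonicPolynomial (p : MvPolynomial (Fin 2) ℝ) : Prop :=
  InnerProductSpace.HarmonicOnNhd (fun z : ℂ => MvPolynomial.eval ![z.re, z.im] p) Set.univ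

/-!
Both directions rest on writing `f` as the real part of an entire function `F` and computing the
derivatives at `s = 0` of the orbit sum `s ↦ ∑ k, f (x + θ ^ k * (s * y))` in the real variable `s`.
The `m`-th one is `Re ((∑ k, θ ^ (m * k)) * y ^ m * F⁽ᵐ⁾(x))`
(`Complex.iteratedDeriv_sum_re_comp_add_pow_mul`), and the sum of powers of `θ` is `0` for
`0 < m < N` and `N` for `m = N`.

If `f` solves the equation, then averaging it against a rotation-invariant smooth bump gives back a
multiple of `f`, so `f` is smooth (`SolvesKNW.contDiff`). The Laplacian in `y` of the orbit sum is,
at `y = 0`, equal to `N * Δ f x` by rotation invariance, whereas the equation says that the orbit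
sum does not depend on `y`; so `f` is harmonic (`SolvesKNW.harmonicOnNhd`) and `F` exists. The case
`m = N` of the derivative formula now gives `Re (y ^ N * F⁽ᴺ⁾(x)) = 0` for all `y`, hence
`F⁽ᴺ⁾ = 0`: `F` is a polynomial of degree less than `N`, and `f` is its real part.

Conversely, if `f` is a harmonic polynomial of degree less than `N`, then the orbit sum is a
polynomial in `s` of degree less than `N` whose derivatives of orders `1, …, N - 1` vanish at `0`.
Hence it is constant, and comparing `s = 1` with `s = 0` gives the equation. The degree of `F` is
never needed in this direction.
-/

/-! ### Regularity of solutions -/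

theorem SolvesKNW.sum_eq {N : ℕ} (hN : N ≠ 0) {θ : ℂ} {f : ℂ → ℝ} (h : SolvesKNW N θ f)
    (x y : ℂ) : ∑ k ∈ Finset.range N, f (x + θ ^ k * y) = N * f x := by
  have hN' : (N : ℝ) ≠ 0 := Nat.cast_ne_zero.2 hN
  rw [← h x y, ← mul_assoc, mul_one_div_cancel hN', one_mul]

open MeasureTheory in
/-- A continuous solution is twice continuously differentiable, because up to a normalizing
constant it equals its own convolution with a rotation-invariant smooth bump. Only `‖θ‖ = 1` is
needed here. -/
theorem SolvesKNW.contDiff {N : ℕ} (hN : N ≠ 0) {θ : ℂ} (hθ : ‖θ‖ = 1) {f : ℂ → ℝ}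
    (hf : Continuous f) (h : SolvesKNW N θ f) : ContDiff ℝ 2 f := by
  set φ : ℂ → ℝ := fun z ↦ Real.smoothTransition (1 - ‖z‖ ^ 2) with hφ
  have hφsmooth : ContDiff ℝ 2 φ :=
    Real.smoothTransition.contDiff.comp (contDiff_const.sub (contDiff_norm_sq ℝ))
  have hφsupp : HasCompactSupport φ := by
    refine HasCompactSupport.intro (isCompact_closedBall (0 : ℂ) 1) fun z hz ↦ ?_
    have hz' : 1 < ‖z‖ := by simpa using hz
    exact Real.smoothTransition.zero_of_nonpos (by nlinarith)
  have hφrot (u : ℂ) (hu : ‖u‖ = 1) (z : ℂ) : φ (u * z) = φ z := by simp [hφ, hu]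
  have hφpos : 0 < ∫ z, φ z :=
    hφsmooth.continuous.integral_pos_of_hasCompactSupport_nonneg_nonzero hφsupp
      (fun z ↦ Real.smoothTransition.nonneg _) (x := 0) (by simp [hφ])
  have hint (x u : ℂ) : Integrable fun z ↦ φ z * f (x - u * z) :=
    (hφsmooth.continuous.mul (hf.comp (by fun_prop))).integrable_of_hasCompactSupport
      hφsupp.mul_right
  have hrot (x u : ℂ) (hu : ‖u‖ = 1) :
      ∫ z, φ z * f (x - u * z) = ∫ z, φ z * f (x - z) := by
    let L : ℂ ≃ₗᵢ[ℝ] ℂ := rotation ⟨u, mem_sphere_zero_iff_norm.2 hu⟩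
    have hL (z : ℂ) : L z = u * z := rotation_apply _ z
    rw [← L.measurePreserving.integral_comp L.toHomeomorph.measurableEmbedding
      fun z ↦ φ z * f (x - z)]
    simp only [hL, hφrot u hu]
  have hconv (x : ℂ) : ∫ z, φ z * f (x - z) = (∫ z, φ z) * f x := by
    have hN' : (N : ℝ) ≠ 0 := Nat.cast_ne_zero.2 hN
    calc ∫ z, φ z * f (x - z)
        = 1 / (N : ℝ) * ∑ k ∈ Finset.range N, ∫ z, φ z * f (x - θ ^ k * z) := by
          have hθk (k : ℕ) : ‖θ ^ k‖ = 1 := by rw [norm_pow, hθ, one_pow]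
          simp only [hrot x _ (hθk _)]
          simp [hN']
      -- The equation is applied with `y = -z`, because the convolution samples `f` at `x - z`.
      _ = ∫ z, φ z * (1 / (N : ℝ) * ∑ k ∈ Finset.range N, f (x + θ ^ k * -z)) := by
          rw [← integral_finsetSum _ fun k _ ↦ hint x _, ← integral_const_mul]
          congr with z
          simp only [mul_neg, ← sub_eq_add_neg, Finset.mul_sum]
          exact Finset.sum_congr rfl fun k _ ↦ by ring
      _ = (∫ z, φ z) * f x := by simp only [h x, integral_mul_const]
  have hfeq : f = fun x ↦ (∫ z, φ z)⁻¹ *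
      (convolution φ f (ContinuousLinearMap.mul ℝ ℝ) volume) x := by
    funext x
    rw [convolution_def]
    simp only [ContinuousLinearMap.mul_apply', hconv]
    field_simp
  rw [hfeq]
  exact contDiff_const.mul
    (hφsupp.contDiff_convolution_left (n := 2) _ hφsmooth hf.locallyIntegrable)

open Laplacian in
/-- The Laplacian is invariant under linear isometries. -/
theorem InnerProductSpace.laplacian_comp_linearIsometryEquiv {E F : Type*}
    [NormedAddCommGroup E] [InnerProductSpace ℝ E] [FiniteDimensional ℝ E]
    [NormedAddCommGroup F] [NormedSpace ℝ F] {f : E → F} (hf : ContDiff ℝ 2 f)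
    (L : E ≃ₗᵢ[ℝ] E) (x : E) : Δ (f ∘ L) x = Δ f (L x) := by
  rw [laplacian_eq_iteratedFDeriv_stdOrthonormalBasis,
    laplacian_eq_iteratedFDeriv_orthonormalBasis f ((stdOrthonormalBasis ℝ E).map L)]
  refine Finset.sum_congr rfl fun i _ ↦ ?_
  have := (L.toContinuousLinearEquiv : E →L[ℝ] E).iteratedFDeriv_comp_right hf x (i := 2) le_rfl
  have h2 := congrArg (fun M ↦ M ![stdOrthonormalBasis ℝ E i, stdOrthonormalBasis ℝ E i]) this
  refine h2.trans ?_
  simp only [ContinuousMultilinearMap.compContinuousLinearMap_apply]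
  refine congrArg _ (funext fun j ↦ ?_)
  fin_cases j <;> rfl

open Laplacian InnerProductSpace in
/-- Applying the Laplacian in `y` at `y = 0` to the equation gives harmonicity, since each of the
`N` rotated terms contributes `Δ f x`. -/
theorem SolvesKNW.harmonicOnNhd {N : ℕ} (hN : N ≠ 0) {θ : ℂ} (hθ : ‖θ‖ = 1) {f : ℂ → ℝ}
    (hf : Continuous f) (h : SolvesKNW N θ f) : HarmonicOnNhd f Set.univ := by
  have hsm := h.contDiff hN hθ hf
  have hN' : (N : ℝ) ≠ 0 := Nat.cast_ne_zero.2 hN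
  suffices hΔ : ∀ x, Δ f x = 0 from fun x _ ↦
    ⟨hsm.contDiffAt, Filter.Eventually.of_forall hΔ⟩
  intro x
  have hterm (k : ℕ) : Δ (fun y ↦ f (x + θ ^ k * y)) 0 = Δ f x := by
    let u : Circle := ⟨θ ^ k, mem_sphere_zero_iff_norm.2 (by rw [norm_pow, hθ, one_pow])⟩
    have hL : (fun y ↦ f (x + θ ^ k * y)) = (fun z ↦ f (x + z)) ∘ rotation u :=
      funext fun y ↦ congrArg (fun z ↦ f (x + z)) (rotation_apply u y).symm
    rw [hL, laplacian_comp_linearIsometryEquiv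
      (f := fun z ↦ f (x + z)) (hsm.comp (by fun_prop)), map_zero]
    simp only [laplacian_eq_iteratedFDeriv_complexPlane, iteratedFDeriv_comp_add_left, add_zero]
  have hsum : Δ (fun y ↦ ∑ k ∈ Finset.range N, f (x + θ ^ k * y)) 0 =
      ∑ k ∈ Finset.range N, Δ (fun y ↦ f (x + θ ^ k * y)) 0 := by
    simp only [laplacian_eq_iteratedFDeriv_complexPlane]
    rw [iteratedFDeriv_fun_sum_apply fun k _ ↦
      ContDiff.contDiffAt (f := fun y ↦ f (x + θ ^ k * y)) (hsm.comp (by fun_prop))]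
    simp [Finset.sum_add_distrib]
  rw [funext (h.sum_eq hN x), laplacian_const] at hsum
  simpa [hterm, hN'] using hsum.symm

/-! ### Derivatives of orbit sums -/

/-- Real differentiation along the real axis commutes with taking the real part. -/
theorem Complex.iteratedDeriv_re_comp_ofReal {G : ℂ → ℂ} (hG : Differentiable ℂ G) (m : ℕ) :
    iteratedDeriv m (fun s : ℝ ↦ (G s).re) = fun s : ℝ ↦ (iteratedDeriv m G s).re := by
  induction m with
  | zero => simp
  | succ m ih =>
    rw [iteratedDeriv_succ, ih]
    funext s
    rw [iteratedDeriv_succ]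
    have hd : Differentiable ℂ (iteratedDeriv m G) :=
      hG.contDiff.differentiable_iteratedDeriv m (WithTop.coe_lt_top _)
    exact (hd _).hasDerivAt.real_of_complex.deriv

/-- The derivatives at `s = 0` of the orbit sum of `Re F` along the ray `s ↦ s * y`. The factor
`∑ k, (θ ^ m) ^ k` is what makes most of them vanish when `θ` is a root of unity. -/
theorem Complex.iteratedDeriv_sum_re_comp_add_pow_mul {F : ℂ → ℂ} (hF : Differentiable ℂ F)
    (N m : ℕ) (θ x y : ℂ) :
    iteratedDeriv m (fun s : ℝ ↦ ∑ k ∈ Finset.range N, (F (x + θ ^ k * (s * y))).re) 0 =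
      ((∑ k ∈ Finset.range N, (θ ^ m) ^ k) * (y ^ m * iteratedDeriv m F x)).re := by
  have hG : Differentiable ℂ fun s : ℂ ↦ ∑ k ∈ Finset.range N, F (x + θ ^ k * y * s) := by
    fun_prop
  have key : iteratedDeriv m (fun s : ℂ ↦ ∑ k ∈ Finset.range N, F (x + θ ^ k * y * s)) 0 =
      (∑ k ∈ Finset.range N, (θ ^ m) ^ k) * (y ^ m * iteratedDeriv m F x) := by
    rw [iteratedDeriv_fun_sum fun k _ ↦
      (Differentiable.contDiff (by fun_prop)).contDiffAt, Finset.sum_mul]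
    refine Finset.sum_congr rfl fun k _ ↦ ?_
    have hshift : ContDiff ℂ m fun z ↦ F (x + z) := Differentiable.contDiff (by fun_prop)
    rw [iteratedDeriv_comp_const_mul hshift (θ ^ k * y), iteratedDeriv_comp_const_add]
    simp only [mul_zero, add_zero]
    ring
  have hre := congrFun (Complex.iteratedDeriv_re_comp_ofReal hG m) 0
  rw [Complex.ofReal_zero, key] at hre
  rw [← hre]
  congr 1
  funext s
  rw [Complex.re_sum]
  exact Finset.sum_congr rfl fun k _ ↦ by rw [mul_assoc, mul_comm y]

/-! ### Polynomials -/

theorem Polynomial.iteratedDeriv_eval {𝕜 : Type*} [NontriviallyNormedField 𝕜] (q : Polynomial 𝕜)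
    (m : ℕ) : iteratedDeriv m (fun s ↦ q.eval s) = fun s ↦ (derivative^[m] q).eval s := by
  induction m with
  | zero => simp
  | succ m ih =>
    rw [iteratedDeriv_succ, ih]
    funext s
    rw [Polynomial.deriv, Function.iterate_succ_apply']

/-- A polynomial of degree less than `N` whose derivatives of orders `1, …, N - 1` vanish at `0`
is constant. -/
theorem Polynomial.eval_eq_eval_zero_of_iteratedDeriv_eq_zero {q : Polynomial ℝ} {N : ℕ}
    (hq : q.natDegree < N)
    (h : ∀ m, m ≠ 0 → m < N → iteratedDeriv m (fun s ↦ q.eval s) 0 = 0) (s : ℝ) :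
    q.eval s = q.eval 0 := by
  have hcoeff (m : ℕ) (hm : m ≠ 0) : q.coeff m = 0 := by
    rcases lt_or_ge m N with hmN | hmN
    · have := h m hm hmN
      simp only [Polynomial.iteratedDeriv_eval] at this
      rw [← Polynomial.coeff_zero_eq_eval_zero,
        Polynomial.coeff_iterate_derivative] at this
      simpa [Nat.descFactorial_self, m.factorial_ne_zero] using this
    · exact Polynomial.coeff_eq_zero_of_natDegree_lt (hq.trans_le hmN)
  have hC : q = Polynomial.C (q.coeff 0) := by
    ext m
    rcases eq_or_ne m 0 with rfl | hm
    · simp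
    · rw [hcoeff m hm, Polynomial.coeff_C_of_ne_zero hm]
  rw [hC]
  simp

/-- The real and imaginary parts of `(x + iy) ^ n` are real polynomials of degree at most `n`. -/
theorem MvPolynomial.exists_eval_eq_re_im_pow (n : ℕ) :
    ∃ R J : MvPolynomial (Fin 2) ℝ, R.totalDegree ≤ n ∧ J.totalDegree ≤ n ∧
      ∀ z : ℂ, eval ![z.re, z.im] R = (z ^ n).re ∧ eval ![z.re, z.im] J = (z ^ n).im := by
  induction n with
  | zero => exact ⟨1, 0, by simp, by simp, by simp⟩
  | succ n ih =>
    obtain ⟨R, J, hR, hJ, h⟩ := ih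
    have hX (P : MvPolynomial (Fin 2) ℝ) (hP : P.totalDegree ≤ n) (i : Fin 2) :
        (P * X i).totalDegree ≤ n + 1 :=
      (totalDegree_mul _ _).trans (add_le_add hP (totalDegree_X i).le)
    refine ⟨R * X 0 - J * X 1, R * X 1 + J * X 0,
      (totalDegree_sub _ _).trans (max_le (hX R hR 0) (hX J hJ 1)),
      (totalDegree_add _ _).trans (max_le (hX R hR 1) (hX J hJ 0)), fun z ↦ ?_⟩
    simp [pow_succ, (h z).1, (h z).2]

/-- An entire function whose `N`-th derivative vanishes identically has as real part a real
polynomial of total degree at most `N - 1` in the two real coordinates. -/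
theorem Complex.exists_mvPolynomial_eval_eq_re {F : ℂ → ℂ} (hF : Differentiable ℂ F) {N : ℕ}
    (h : iteratedDeriv N F = 0) :
    ∃ p : MvPolynomial (Fin 2) ℝ, p.totalDegree ≤ N - 1 ∧
      ∀ z : ℂ, MvPolynomial.eval ![z.re, z.im] p = (F z).re := by
  have hhigh (n : ℕ) (hn : N ≤ n) : iteratedDeriv n F 0 = 0 := by
    obtain ⟨j, rfl⟩ := Nat.exists_eq_add_of_le' hn
    rw [iteratedDeriv_eq_iterate, Function.iterate_add_apply, ← iteratedDeriv_eq_iterate,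
      ← iteratedDeriv_eq_iterate, h]
    simp
  have htaylor (z : ℂ) :
      F z = ∑ n ∈ Finset.range N, (n.factorial : ℂ)⁻¹ * iteratedDeriv n F 0 * z ^ n := by
    rw [← Complex.taylorSeries_eq_of_entire' 0 z hF]
    simp only [sub_zero]
    refine tsum_eq_sum fun n hn ↦ ?_
    rw [hhigh n (by simpa using hn), mul_zero, zero_mul]
  set a : ℕ → ℂ := fun n ↦ (n.factorial : ℂ)⁻¹ * iteratedDeriv n F 0
  choose R J hR hJ hRJ using MvPolynomial.exists_eval_eq_re_im_pow
  refine ⟨∑ n ∈ Finset.range N,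
    (MvPolynomial.C (a n).re * R n - MvPolynomial.C (a n).im * J n), ?_, fun z ↦ ?_⟩
  · refine MvPolynomial.totalDegree_finsetSum_le fun n hn ↦ ?_
    have hC (c : ℝ) (P : MvPolynomial (Fin 2) ℝ) (hP : P.totalDegree ≤ n) :
        (MvPolynomial.C c * P).totalDegree ≤ N - 1 := by
      have h1 := MvPolynomial.totalDegree_mul (MvPolynomial.C c) P
      rw [MvPolynomial.totalDegree_C] at h1
      have h2 := Finset.mem_range.1 hn
      omega
    exact (MvPolynomial.totalDegree_sub _ _).trans
      (max_le (hC _ _ (hR n)) (hC _ _ (hJ n)))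
  · rw [htaylor z, map_sum, Complex.re_sum]
    refine Finset.sum_congr rfl fun n _ ↦ ?_
    simp [a, (hRJ n z).1, (hRJ n z).2, Complex.mul_re]

/-- The restriction of a polynomial in two variables to a real line in the plane is a polynomial
in the parameter, of no larger degree. -/
theorem MvPolynomial.exists_polynomial_eval_line (p : MvPolynomial (Fin 2) ℝ) (x w : ℂ) :
    ∃ q : Polynomial ℝ, q.natDegree ≤ p.totalDegree ∧
      ∀ s : ℝ, q.eval s = eval ![(x + w * s).re, (x + w * s).im] p := by
  refine ⟨aeval ![Polynomial.C w.re * Polynomial.X + Polynomial.C x.re,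
    Polynomial.C w.im * Polynomial.X + Polynomial.C x.im] p, ?_, fun s ↦ ?_⟩
  · simpa using aeval_natDegree_le p le_rfl _ (n := 1) fun i ↦ by
      fin_cases i <;> exact Polynomial.natDegree_linear_le
  · rw [← Polynomial.coe_evalRingHom, ← MvPolynomial.aeval_eq_eval]
    change (Polynomial.evalRingHom s) (aeval _ p) = aeval _ p
    rw [MvPolynomial.aeval_def, MvPolynomial.aeval_def, MvPolynomial.hom_eval₂]
    congr 1
    · ext r; simp
    · funext i
      fin_cases i <;> simp [add_comm]

/-! ### Characterization of the solutions -/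

theorem mainTheorem4 (N : ℕ) (hN : 1 ≤ N) (θ : ℂ) (hθ : IsPrimitiveRoot θ N)
    (f : ℂ → ℝ) (hf : Continuous f) :
    SolvesKNW N θ f ↔
      ∃ p : MvPolynomial (Fin 2) ℝ, IsHarmonicPolynomial p ∧ p.totalDegree ≤ N - 1 ∧
        ∀ x y : ℝ, f ((x : ℂ) + (y : ℂ) * Complex.I) = MvPolynomial.eval ![x, y] p := by
  have hN0 : N ≠ 0 := Nat.one_le_iff_ne_zero.1 hN
  have hNR : (N : ℝ) ≠ 0 := Nat.cast_ne_zero.2 hN0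
  constructor
  · intro h
    have hharm := h.harmonicOnNhd hN0 (hθ.norm'_eq_one hN0) hf
    obtain ⟨F, hFan, hFre⟩ := hharm.exists_analyticOnNhd_univ_re_eq
    have hF : Differentiable ℂ F := fun z ↦ (hFan z trivial).differentiableAt
    have hder : iteratedDeriv N F = 0 := by
      funext x
      -- Choosing `y` with `y ^ N` conjugate to `F⁽ᴺ⁾(x)` turns the vanishing real part into `‖·‖²`.
      obtain ⟨y, hy⟩ := IsAlgClosed.exists_pow_nat_eq (starRingEnd ℂ (iteratedDeriv N F x)) hN
      have key := Complex.iteratedDeriv_sum_re_comp_add_pow_mul hF N N θ x y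
      have hconst : (fun s : ℝ ↦ ∑ k ∈ Finset.range N, (F (x + θ ^ k * (s * y))).re) =
          fun _ ↦ (N : ℝ) * f x := by
        funext s
        rw [← h.sum_eq hN0 x (s * y), ← hFre]
      rw [hconst, iteratedDeriv_const, if_neg hN0, hθ.pow_eq_one, hy, mul_comm (starRingEnd ℂ _),
        Complex.mul_conj] at key
      simpa [hN0, Complex.normSq_eq_zero] using key.symm
    obtain ⟨p, hpdeg, hp⟩ := Complex.exists_mvPolynomial_eval_eq_re hF hder
    have hpf (z : ℂ) : MvPolynomial.eval ![z.re, z.im] p = f z := by rw [hp, ← hFre]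
    refine ⟨p, ?_, hpdeg, fun x y ↦ ?_⟩
    · rw [IsHarmonicPolynomial, funext hpf]
      exact hharm
    · simpa using (hpf (x + y * Complex.I)).symm
  · rintro ⟨p, hharm, hpdeg, hp⟩
    have hpf (z : ℂ) : MvPolynomial.eval ![z.re, z.im] p = f z := by
      rw [← hp, Complex.re_add_im]
    rw [IsHarmonicPolynomial, funext hpf] at hharm
    obtain ⟨F, hFan, hFre⟩ := hharm.exists_analyticOnNhd_univ_re_eq
    have hF : Differentiable ℂ F := fun z ↦ (hFan z trivial).differentiableAt
    intro x y
    choose q hqdeg hq using fun k : ℕ ↦ p.exists_polynomial_eval_line x (θ ^ k * y)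
    -- The orbit sum along the segment from `x` to `x + y`, as a polynomial in the parameter.
    set Q := ∑ k ∈ Finset.range N, q k
    have hQ (s : ℝ) : Q.eval s = ∑ k ∈ Finset.range N, f (x + θ ^ k * (s * y)) := by
      rw [Polynomial.eval_finsetSum]
      refine Finset.sum_congr rfl fun k _ ↦ ?_
      rw [hq, hpf, mul_assoc, mul_comm y]
    have hQdeg : Q.natDegree < N :=
      (Polynomial.natDegree_sum_le_of_forall_le _ _
        fun k _ ↦ (hqdeg k).trans hpdeg).trans_lt (by omega)
    have hQder (m : ℕ) (hm : m ≠ 0) (hmN : m < N) :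
        iteratedDeriv m (fun s ↦ Q.eval s) 0 = 0 := by
      have hgeom : ∑ k ∈ Finset.range N, (θ ^ m) ^ k = 0 := by
        have h1 := mul_geom_sum (θ ^ m) N
        rw [← pow_mul, mul_comm m N, pow_mul, hθ.pow_eq_one, one_pow, sub_self] at h1
        exact (mul_eq_zero.1 h1).resolve_left
          (sub_ne_zero.2 (hθ.pow_ne_one_of_pos_of_lt hm hmN))
      have key := Complex.iteratedDeriv_sum_re_comp_add_pow_mul hF N m θ x y
      rw [hgeom, zero_mul, Complex.zero_re] at key
      rw [funext hQ, ← hFre]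
      exact key
    have hQ1 := Polynomial.eval_eq_eval_zero_of_iteratedDeriv_eq_zero hQdeg hQder 1
    rw [hQ, hQ] at hQ1
    simp only [Complex.ofReal_one, one_mul, Complex.ofReal_zero, zero_mul, mul_zero, add_zero,
      Finset.sum_const, Finset.card_range, nsmul_eq_mul] at hQ1
    rw [hQ1]
    field_simp
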